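/- **Setting.** Let $x_1,\dots,x_n\in\mathbb R^m$, $y\in\{-1,1\}^n$, let $\overline{\mathcal Y}\subseteq\{-1,1\}^n$ be a set of admissible label vectors containing at least one element other than $y$, and put $Y_0=\overline{\mathcal Y}\setminus\{y\}$. Let $\Delta$ be a real-valued loss on pairs of label vectors, $C>0$, $B\in\mathbb N$, $\varepsilon\ge 0$, and $\mathcal D=\{d\in\{0,1\}^m:\sum_j d_j\le B\}$. For $d\in\mathcal D$ and $y'\in Y_0$ put $$a^d_{y'}=\tfrac1n\sum_{i=1}^n(y_i-y'_i)(x_i\odot d),\qquad b_{y'}=\tfrac1n\Delta(y,y'),\qquad Q^d_{y',y''}=\langle a^d_{y'},a^d_{y''}\rangle .$$ For $Y\subseteq Y_0$ let $\mathcal A_Y=\{\alpha\in\mathbb R^Y:\alpha\ge 0,\ \sum_{y'\in Y}\alpha_{y'}\le C\}$, regarded as a subset of $\mathcal A=\mathcal A_{Y_0}$ by extension by zero. Define $$S(\alpha,d)=-\tfrac12\sum_{y',y''\in Y_0}\alpha_{y'}\alpha_{y''}Q^d_{y',y''}+\sum_{y'\in Y_0}\alpha_{y'}b_{y'}\quad(\alpha\in\mathcal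 A),$$ $$\Theta^Y_d(\alpha)=-\tfrac12\Big\|\sum_{y'\in Y}\alpha_{y'}a^d_{y'}\Big\|^2+\sum_{y'\in Y}\alpha_{y'}b_{y'}\quad(\alpha\in\mathcal A_Y).$$ For a nonempty $G\subseteq\mathcal D$, the relaxed (multiple kernel learning) problem over $G$ is $$\max_{\alpha\in\mathcal A}\ \min_{\mu\ge0,\ \sum_{d\in G}\mu_d=1}\ -\tfrac12\sum_{y',y''\in Y_0}\alpha_{y'}\alpha_{y''}\sum_{d\in G}\mu_dQ^d_{y',y''}+\sum_{y'\in Y_0}\alpha_{y'}b_{y'} .$$ A pair $(d^*,\alpha^*)$ is an optimal solution of it if there is an optimal $(\mu^*,\alpha^*)$ (that is, $\alpha^*$ attains the maximum and $\mu^*$ attains the minimum at $\alpha^*$) with $\mu^*_{d^*}>0$; equivalently, $(d^*,\alpha^*)$ solves $\max_{\alpha\in\mathcal A}\min_{d\in G}S(\alpha,d)$. For a nonempty pool $W\subseteq\mathcal D$, a set $Y\subseteq Y_0$ and $w=(w_d)_{d\in W}$ with $w_d\in\mathbb R^m$, put $$\mathcal J_{W,Y}(w)=\tfrac12\Big(\sum_{d\in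 W}\|w_d\|\Big)^2+C\max\Big(0,\max_{y'\in Y}\big(b_{y'}-\sum_{d\in W}\langle w_d,a^d_{y'}\rangle\big)\Big),\qquad \mathcal J_W=\mathcal J_{W,Y_0}.$$ **Two-layer cutting plane algorithm.** Start with $W=\emptyset$, $Y=Y_0$ and any $\alpha\in\mathcal A$. Each outer iteration does the following. 1. Choose a most violated group, i.e. a minimizer of $d\mapsto\Theta^Y_d(\alpha)$ over $\mathcal D$, and add it to $W$. 2. Inner layer: set $Y=\emptyset$ and choose any starting point $w^0$. For $k=1,2,\dots$, add to $Y$ a label vector maximizing $b_{y'}-\sum_{d\in W}\langle w^{k-1}_d,a^d_{y'}\rangle$ over $y'\in Y_0$; then let $w^k$ be any minimizer of $\mathcal J_{W,Y}$ and let $\alpha$ be the $\alpha$-part of any solution of the dual problem: maximize $-\theta+\sum_{y'\in Y}\alpha_{y'}b_{y'}$ over $\alpha\in\mathcal A_Y$ and $\theta\in\mathbb R$ subject to $\tfrac12\|\sum_{y'\in Y}\alpha_{y'}a^d_{y'}\|^2\le\theta$ for all $d\in W$. Leave the inner layer as soon as $\min_{0\le j\le k}\mathcal J_W(w^j)-\mathcal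 J_{W,Y}(w^k)\le\varepsilon$. 3. If some $d\in W$ minimizes $\Theta^Y_{d'}(\alpha)$ over all $d'\in\mathcal D$, stop with output $(d,\alpha)$, for any such $d$; otherwise start the next outer iteration. **Theorem.** Every run of the algorithm, for every choice left open, stops after finitely many steps (inner iterations included): the number of steps is bounded by a constant that does not depend on the choices, and no run gets stuck before it stops. If $W$ and $Y$ are the pool and the label set when it stops and $(d,\alpha)$ is the output, then $d\in\mathcal D$, $\alpha\in\mathcal A$, and, both for $G=W$ (the final pool) and for $G=\mathcal D$ (all groups), the relaxed problem over $G$ has an optimal solution, and every optimal solution $(d^*,\alpha^*)$ satisfies $$0\le S(\alpha^*,d^*)-\Theta^Y_d(\alpha)\le\varepsilon .$$ -/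

import Mathlib

noncomputable section

namespace TwoLayer

/-- Label vectors in `{-1, +1}^n`. -/
abbrev Label (n : ℕ) : Type := Fin n → ℤˣ

/-- A group of features, i.e. a 0-1 vector `d` of length `m`, given by its index set
`{j | d j = 1}`. -/
abbrev FeatureGroup (m : ℕ) : Type := Finset (Fin m)

/-- Feature vectors and weight vectors, with the Euclidean norm. -/
abbrev Vec (m : ℕ) : Type := EuclideanSpace ℝ (Fin m)

/-- The data of the learning problem: the training sample `(x i, y i)`, the set of admissible label
vectors, the multivariate loss `Δ`, the regularization parameter `C` and the budget `B`. -/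
structure Problem (n m : ℕ) where
  x : Fin n → Vec m
  y : Label n
  admissible : Finset (Label n)
  loss : Label n → Label n → ℝ
  C : ℝ
  B : ℕ

/-- The elementwise product `x ⊙ d`. -/
def mask {m : ℕ} (x : Vec m) (d : FeatureGroup m) : Vec m :=
  WithLp.toLp 2 fun j => if j ∈ d then x j else 0

namespace Problem

variable {n m : ℕ} (P : Problem n m)

/-- The admissible label vectors other than the true one. -/
def alternatives : Finset (Label n) := P.admissible.erase P.y

/-- The domain `𝒟` of 0-1 vectors with at most `B` ones. -/
def groups : Finset (FeatureGroup m) := Finset.univ.filter fun d => d.card ≤ P.B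

/-- `a_{y'} = (1/n) ∑ i, (y i - y' i) (x i ⊙ d)`. -/
def a (d : FeatureGroup m) (y' : Label n) : Vec m :=
  (1 / (n : ℝ)) • ∑ i, (((P.y i : ℤ) : ℝ) - ((y' i : ℤ) : ℝ)) • mask (P.x i) d

/-- `b_{y'} = (1/n) Δ(y, y')`. -/
def b (y' : Label n) : ℝ := (1 / (n : ℝ)) * P.loss P.y y'

/-- `Q^d_{y', y''} = ⟨a_{y'}, a_{y''}⟩`. -/
def Q (d : FeatureGroup m) (y' y'' : Label n) : ℝ := inner ℝ (P.a d y') (P.a d y'')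

/-- The dual vectors indexed by the label vectors in `Y`:
`{α | α ≥ 0, ∑ y' ∈ Y, α y' ≤ C}`, extended by zero outside `Y`.
It is the set `𝒜` if `Y` consists of all alternatives, and `𝒜_K` if `Y` is the working set
of `K` label vectors. -/
def dualSet (Y : Finset (Label n)) : Set (Label n → ℝ) :=
  {α | (∀ y', 0 ≤ α y') ∧ (∀ y', y' ∉ Y → α y' = 0) ∧ ∑ y' ∈ Y, α y' ≤ P.C}

/-- `S(α, d)`. -/
def S (α : Label n → ℝ) (d : FeatureGroup m) : ℝ :=
  -(1 / 2) * ∑ y' ∈ P.alternatives, ∑ y'' ∈ P.alternatives, α y' * α y'' * P.Q d y' y''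
    + ∑ y' ∈ P.alternatives, α y' * P.b y'

/-! ### The relaxed (multiple kernel learning) problem -/

/-- The kernel weights on the groups in `G`: `{μ | μ ≥ 0, ∑ d ∈ G, μ d = 1}`,
extended by zero outside `G`. -/
def weightSet (G : Finset (FeatureGroup m)) : Set (FeatureGroup m → ℝ) :=
  {μ | (∀ d, 0 ≤ μ d) ∧ (∀ d, d ∉ G → μ d = 0) ∧ ∑ d ∈ G, μ d = 1}

/-- The objective of the MKL problem over the groups in `G`. -/
def mklObjective (G : Finset (FeatureGroup m)) (α : Label n → ℝ) (μ : FeatureGroup m → ℝ) : ℝ :=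
  -(1 / 2) * ∑ y' ∈ P.alternatives, ∑ y'' ∈ P.alternatives,
      α y' * α y'' * ∑ d ∈ G, μ d * P.Q d y' y''
    + ∑ y' ∈ P.alternatives, α y' * P.b y'

/-- `(μ, α)` solves `max_{α ∈ 𝒜} min_{μ}` of the MKL objective over the groups in `G`:
`μ` attains the inner minimum at `α`, and at no other `α'` is the inner minimum larger. -/
structure IsMKLSolution (G : Finset (FeatureGroup m)) (μ : FeatureGroup m → ℝ) (α : Label n → ℝ) : Prop where
  dual_mem : α ∈ P.dualSet P.alternatives
  weight_mem : μ ∈ weightSet G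
  inner_min : ∀ μ' ∈ weightSet G, P.mklObjective G α μ ≤ P.mklObjective G α μ'
  outer_max : ∀ α' ∈ P.dualSet P.alternatives, ∃ μ' ∈ weightSet G,
    P.mklObjective G α' μ' ≤ P.mklObjective G α μ

/-- `(d, α)` is an optimal solution of the MKL problem over the groups in `G`: `α` is optimal and
`d` is a group that carries positive weight in an optimal `μ`. Equivalently, `(d, α)` solves
`max_{α ∈ 𝒜} min_{d ∈ G} S(α, d)`. -/
def IsOptimalPair (G : Finset (FeatureGroup m)) (d : FeatureGroup m) (α : Label n → ℝ) : Prop :=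
  ∃ μ, P.IsMKLSolution G μ α ∧ 0 < μ d

/-! ### The primal problem of group selection, and its cutting planes -/

/-- `Ω(w) = (1/2) (∑ t, ‖w_t‖)^2`. Here and below the blocks of `w` are indexed by groups,
and only the blocks `w d` with `d ∈ W` matter. -/
def Omega (W : Finset (FeatureGroup m)) (w : FeatureGroup m → Vec m) : ℝ := (1 / 2) * (∑ d ∈ W, ‖w d‖) ^ 2

/-- The slack `b_{y'} - ∑ t, ⟨w_t, a^t_{y'}⟩` that the constraint of `y'` requires. -/
def violation (W : Finset (FeatureGroup m)) (w : FeatureGroup m → Vec m) (y' : Label n) : ℝ :=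
  P.b y' - ∑ d ∈ W, inner ℝ (w d) (P.a d y')

/-- The empirical risk `max (0, max_{y'} (b_{y'} - ∑ t, ⟨w_t, a^t_{y'}⟩))`. -/
def empRisk (W : Finset (FeatureGroup m)) (w : FeatureGroup m → Vec m) : ℝ :=
  P.alternatives.fold max 0 (P.violation W w)

/-- `𝒥(w) = Ω(w) + C R_emp(w)`. -/
def J (W : Finset (FeatureGroup m)) (w : FeatureGroup m → Vec m) : ℝ := Omega W w + P.C * P.empRisk W w

/-- The block `p_t` of the cutting plane generated by `y'`. -/
def p (d : FeatureGroup m) (y' : Label n) : Vec m :=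
  -((1 / (n : ℝ)) • ∑ i, (((P.y i : ℤ) : ℝ) - ((y' i : ℤ) : ℝ)) • mask (P.x i) d)

/-- The offset `q` of the cutting plane generated by `y'`. -/
def q (y' : Label n) : ℝ := (1 / (n : ℝ)) * P.loss P.y y'

/-- The piecewise linear lower bound `max (0, max_{k} (⟨w, p^k⟩ + q^k))` of the empirical risk
given by the cutting planes of the label vectors in the working set `Y`. -/
def cutRisk (W : Finset (FeatureGroup m)) (Y : Finset (Label n)) (w : FeatureGroup m → Vec m) : ℝ :=
  Y.fold max 0 fun y' => ∑ d ∈ W, inner ℝ (w d) (P.p d y') + P.q y'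

/-- `𝒥_K(w) = Ω(w) + C R_emp^K(w)`. -/
def JCut (W : Finset (FeatureGroup m)) (Y : Finset (Label n)) (w : FeatureGroup m → Vec m) : ℝ :=
  Omega W w + P.C * P.cutRisk W Y w

/-- `w` solves the reduced primal problem over the groups `W` and the working set `Y`. -/
def IsReducedPrimalSolution (W : Finset (FeatureGroup m)) (Y : Finset (Label n))
    (w : FeatureGroup m → Vec m) : Prop :=
  ∀ w', P.JCut W Y w ≤ P.JCut W Y w'

/-- Feasibility for the QCQP over the groups `W` and the working set `Y`. -/
def QCQPFeasible (W : Finset (FeatureGroup m)) (Y : Finset (Label n)) (α : Label n → ℝ) (θ : ℝ) : Prop :=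
  α ∈ P.dualSet Y ∧ ∀ d ∈ W, (1 / 2) * ‖∑ y' ∈ Y, α y' • P.p d y'‖ ^ 2 ≤ θ

/-- `α` is the dual part of a maximizer of the QCQP, whose objective is `-θ + ∑ k, α_k q^k`. -/
def IsQCQPSolution (W : Finset (FeatureGroup m)) (Y : Finset (Label n)) (α : Label n → ℝ) : Prop :=
  ∃ θ, P.QCQPFeasible W Y α θ ∧ ∀ α' θ', P.QCQPFeasible W Y α' θ' →
    -θ' + ∑ y' ∈ Y, α' y' * P.q y' ≤ -θ + ∑ y' ∈ Y, α y' * P.q y'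

/-- `𝒢_d(α) = (1/2) ‖∑ k, α_k p^k_d‖^2 - ∑ k, α_k q^k` over the working set `Y`. -/
def reducedG (Y : Finset (Label n)) (d : FeatureGroup m) (α : Label n → ℝ) : ℝ :=
  (1 / 2) * ‖∑ y' ∈ Y, α y' • P.p d y'‖ ^ 2 - ∑ y' ∈ Y, α y' * P.q y'

/-- `Θ_d(α) = -𝒢_d(α)`, the counterpart of `S(α, d)` over the working set `Y`. -/
def Theta (Y : Finset (Label n)) (d : FeatureGroup m) (α : Label n → ℝ) : ℝ := -P.reducedG Y d α

/-- `y'` is a most violated label vector at `w`. -/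
def IsMostViolatedLabel (W : Finset (FeatureGroup m)) (w : FeatureGroup m → Vec m) (y' : Label n) : Prop :=
  y' ∈ P.alternatives ∧ ∀ y'' ∈ P.alternatives,
    P.loss P.y y'' - ∑ i, (((P.y i : ℤ) : ℝ) - ((y'' i : ℤ) : ℝ))
        * ∑ d ∈ W, inner ℝ (w d) (mask (P.x i) d)
      ≤ P.loss P.y y' - ∑ i, (((P.y i : ℤ) : ℝ) - ((y' i : ℤ) : ℝ))
        * ∑ d ∈ W, inner ℝ (w d) (mask (P.x i) d)

/-- `d` is a most violated group at `α`: it maximizes `𝒢_d(α)` over `𝒟`. -/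
def IsMostViolatedGroup (Y : Finset (Label n)) (α : Label n → ℝ) (d : FeatureGroup m) : Prop :=
  d ∈ P.groups ∧ ∀ d' ∈ P.groups, P.reducedG Y d' α ≤ P.reducedG Y d α

end Problem

/-! ### The two-layer algorithm as a transition system -/

/-- The states of the algorithm.
* `generate W Y α`: start of an outer iteration, with pool of groups `W` and current dual vector `α`
  over the label vectors `Y`;
* `select W Y w best`: start of an inner iteration, with pool of groups `W`, working set `Y`, current
  primal point `w`, and the smallest value `best` of `𝒥` at the primal points so far;
* `finished W Y d α`: the algorithm has stopped with output `(d, α)`, where `W` and `Y` are the final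
  pool of groups and the final working set. -/
inductive State (n m : ℕ) : Type
  | generate (W : Finset (FeatureGroup m)) (Y : Finset (Label n)) (α : Label n → ℝ)
  | select (W : Finset (FeatureGroup m)) (Y : Finset (Label n)) (w : FeatureGroup m → Vec m) (best : ℝ)
  | finished (W : Finset (FeatureGroup m)) (Y : Finset (Label n)) (d : FeatureGroup m) (α : Label n → ℝ)

variable {n m : ℕ}

/-- The body of one inner iteration from the working set `Y` and the point `w`: a most violated
label vector is added to the working set, which becomes `Y'`, and the reduced problem over `W` and
`Y'` is solved, with primal solution `w'` and dual (QCQP) solution `α'`. -/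
def InnerIteration (P : Problem n m) (W : Finset (FeatureGroup m)) (Y : Finset (Label n))
    (w : FeatureGroup m → Vec m) (Y' : Finset (Label n)) (w' : FeatureGroup m → Vec m) (α' : Label n → ℝ) :
    Prop :=
  (∃ y', P.IsMostViolatedLabel W w y' ∧ Y' = insert y' Y) ∧
    P.IsReducedPrimalSolution W Y' w' ∧ P.IsQCQPSolution W Y' α'

/-- One step of the algorithm. Ties between maximizers, the choice among several solutions of a
subproblem, and the starting point `w₀` of each call of the inner layer are left open. -/
inductive Step (P : Problem n m) (ε : ℝ) : State n m → State n m → Prop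
  /-- A most violated group joins the pool, and the inner layer is called with empty working set. -/
  | generate {W Y α d} (w₀ : FeatureGroup m → Vec m) (hd : P.IsMostViolatedGroup Y α d) :
      Step P ε (.generate W Y α) (.select (insert d W) ∅ w₀ (P.J (insert d W) w₀))
  /-- An inner iteration after which the inner layer is not yet `ε`-optimal. -/
  | again {W Y w best Y' w' α'} (hi : InnerIteration P W Y w Y' w' α')
      (hε : ¬ min best (P.J W w') - P.JCut W Y' w' ≤ ε) :
      Step P ε (.select W Y w best) (.select W Y' w' (min best (P.J W w')))
  /-- The inner layer returns, but every most violated group is still outside the pool. -/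
  | back {W Y w best Y' w' α'} (hi : InnerIteration P W Y w Y' w' α')
      (hε : min best (P.J W w') - P.JCut W Y' w' ≤ ε)
      (hc : ¬ ∃ d ∈ W, P.IsMostViolatedGroup Y' α' d) :
      Step P ε (.select W Y w best) (.generate W Y' α')
  /-- The inner layer returns, and a most violated group `d` already belongs to the pool. -/
  | halt {W Y w best Y' w' α' d} (hi : InnerIteration P W Y w Y' w' α')
      (hε : min best (P.J W w') - P.JCut W Y' w' ≤ ε)
      (hd : d ∈ W) (hc : P.IsMostViolatedGroup Y' α' d) :
      Step P ε (.select W Y w best) (.finished W Y' d α')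

/-- The algorithm starts with an empty pool of groups and some dual vector in `𝒜`. -/
def IsInitial (P : Problem n m) (s : State n m) : Prop :=
  ∃ α₀ ∈ P.dualSet P.alternatives, s = .generate ∅ P.alternatives α₀

/-- The algorithm has stopped. -/
def IsFinished (s : State n m) : Prop := ∃ W Y d α, s = .finished W Y d α

end TwoLayer

end

noncomputable section

namespace TwoLayer

namespace Problem

variable {n m : ℕ} (P : Problem n m)

/-! ### The dual set -/

/-! Strong duality and two monotone counters carry the proof. For a nonempty pool `W`, the minimum
of `JCut W Y` equals the maximum over `α ∈ dualSet Y` of `min_{d ∈ W} Theta Y d α`. Weak duality is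
Hölder's inequality for `∑ ‖w d‖` against the largest block norm; the converse comes from a saddle
point of the Lagrangian (Sion), after restricting `w` to a ball (`exists_JCut_le_theta`).

Termination: a most violated label already in `Y` would make the cutting-plane model exact at the
current `w`, so the gap would be at most `0 ≤ ε` and the inner layer would have been left; a most
violated group already in `W` would have stopped the run. Labels and groups are therefore always
new, and there are finitely many of them.

Accuracy (`Invariant.gap_bounds`): `α` is feasible for the relaxed problem and `d` minimizes `Theta
Y · α` over all groups, so the optimum is at least `Theta Y d α`. Weak duality at the best primal
point, the stopping rule and strong duality for `(W, Y)` bound it by `Theta Y d α + ε`. -/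

theorem zero_mem_dualSet (hC : 0 < P.C) (Y : Finset (Label n)) : 0 ∈ P.dualSet Y := by
  refine ⟨fun _ => le_rfl, fun _ _ => rfl, ?_⟩
  simpa using hC.le

theorem convex_dualSet (Y : Finset (Label n)) : Convex ℝ (P.dualSet Y) := by
  rintro α ⟨h1, h2, h3⟩ β ⟨k1, k2, k3⟩ s t hs ht hst
  refine ⟨fun y => ?_, fun y hy => ?_, ?_⟩
  · have := h1 y
    have := k1 y
    simp only [Pi.add_apply, Pi.smul_apply, smul_eq_mul]
    positivity
  · simp [h2 y hy, k2 y hy]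
  · simp only [Pi.add_apply, Pi.smul_apply, smul_eq_mul, Finset.sum_add_distrib, ← Finset.mul_sum]
    calc s * ∑ y ∈ Y, α y + t * ∑ y ∈ Y, β y ≤ s * P.C + t * P.C := by gcongr
      _ = P.C := by rw [← add_mul, hst, one_mul]

theorem le_C_of_mem_dualSet (hC : 0 < P.C) {Y : Finset (Label n)} {α : Label n → ℝ}
    (hα : α ∈ P.dualSet Y) (y : Label n) : α y ≤ P.C := by
  by_cases hy : y ∈ Y
  · exact (Finset.single_le_sum (fun i _ => hα.1 i) hy).trans hα.2.2
  · rw [hα.2.1 y hy]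
    exact hC.le

theorem isCompact_dualSet (hC : 0 < P.C) (Y : Finset (Label n)) : IsCompact (P.dualSet Y) := by
  have hclosed : IsClosed (P.dualSet Y) := by
    have : P.dualSet Y = (⋂ y, {α | 0 ≤ α y}) ∩ ((⋂ y, {α | y ∉ Y → α y = 0}) ∩
        {α | ∑ y ∈ Y, α y ≤ P.C}) := by
      ext α
      simp [dualSet]
    rw [this]
    refine (isClosed_iInter fun y => isClosed_le continuous_const (continuous_apply y)).inter
      ((isClosed_iInter fun y => ?_).inter (isClosed_le (by fun_prop) continuous_const))
    by_cases hy : y ∈ Y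
    · simp [hy]
    · simpa [hy] using isClosed_eq (continuous_apply y) continuous_const
  refine (isCompact_univ_pi fun _ : Label n => isCompact_Icc (a := 0) (b := P.C)).of_isClosed_subset
    hclosed fun α hα y _ => ⟨hα.1 y, P.le_C_of_mem_dualSet hC hα y⟩

theorem dualSet_mono {Y Y' : Finset (Label n)} (h : Y ⊆ Y') : P.dualSet Y ⊆ P.dualSet Y' := by
  rintro α ⟨h1, h2, h3⟩
  refine ⟨h1, fun y hy => h2 y fun hy' => hy (h hy'), ?_⟩
  rwa [← Finset.sum_subset h fun y _ hy => h2 y hy]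

/-! ### Reformulations -/

theorem theta_eq (Y : Finset (Label n)) (d : FeatureGroup m) (α : Label n → ℝ) :
    P.Theta Y d α = ∑ y ∈ Y, α y * P.b y - (1 / 2) * ‖∑ y ∈ Y, α y • P.a d y‖ ^ 2 := by
  have : ∑ y ∈ Y, α y • P.p d y = -∑ y ∈ Y, α y • P.a d y := by
    rw [← Finset.sum_neg_distrib]
    exact Finset.sum_congr rfl fun y _ => smul_neg _ _
  rw [Theta, reducedG, this, norm_neg, neg_sub]
  rfl

theorem theta_mono {Y Y' : Finset (Label n)} (h : Y ⊆ Y') (d : FeatureGroup m) {α : Label n → ℝ}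
    (hα : α ∈ P.dualSet Y) : P.Theta Y' d α = P.Theta Y d α := by
  rw [theta_eq, theta_eq, ← Finset.sum_subset h fun y _ hy => by simp [hα.2.1 y hy],
    ← Finset.sum_subset h fun y _ hy => by simp [hα.2.1 y hy]]

theorem S_eq_theta (α : Label n → ℝ) (d : FeatureGroup m) :
    P.S α d = P.Theta P.alternatives d α := by
  rw [theta_eq, ← real_inner_self_eq_norm_sq, sum_inner, S]
  simp only [inner_sum, inner_smul_left, inner_smul_right, Q, RCLike.conj_to_real, mul_assoc]
  simp only [mul_left_comm]
  ring

theorem continuous_theta (Y : Finset (Label n)) (d : FeatureGroup m) :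
    Continuous fun α => P.Theta Y d α := by
  simp only [theta_eq]
  fun_prop

theorem cutRisk_eq (W : Finset (FeatureGroup m)) (Y : Finset (Label n)) (w : FeatureGroup m → Vec m) :
    P.cutRisk W Y w = Y.fold max 0 (P.violation W w) := by
  refine Finset.fold_congr fun y _ => ?_
  have : ∀ d, P.p d y = -P.a d y := fun _ => rfl
  have hq : P.q y = P.b y := rfl
  simp only [this, hq, inner_neg_right, Finset.sum_neg_distrib, violation]
  ring

theorem J_eq_JCut (W : Finset (FeatureGroup m)) (w : FeatureGroup m → Vec m) :
    P.J W w = P.JCut W P.alternatives w := by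
  rw [J, JCut, cutRisk_eq, empRisk]

/-- The scaled form of the constraint used to select label vectors. -/
theorem violation_eq (W : Finset (FeatureGroup m)) (w : FeatureGroup m → Vec m) (y' : Label n) :
    P.violation W w y' = (1 / (n : ℝ)) *
      (P.loss P.y y' - ∑ i, (((P.y i : ℤ) : ℝ) - ((y' i : ℤ) : ℝ))
        * ∑ d ∈ W, inner ℝ (w d) (mask (P.x i) d)) := by
  simp only [violation, a, b, inner_smul_right, inner_sum, mul_sub, Finset.mul_sum]
  rw [Finset.sum_comm]

theorem violation_le_of_isMostViolatedLabel {W : Finset (FeatureGroup m)}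
    {w : FeatureGroup m → Vec m} {y' y'' : Label n} (h : P.IsMostViolatedLabel W w y')
    (hy : y'' ∈ P.alternatives) : P.violation W w y'' ≤ P.violation W w y' := by
  rw [violation_eq, violation_eq]
  exact mul_le_mul_of_nonneg_left (h.2 y'' hy) (by positivity)

/-! ### Lagrangian duality for the reduced problem -/

/-- The Lagrangian of the reduced problem. -/
def lagrangian (W : Finset (FeatureGroup m)) (Y : Finset (Label n)) (w : FeatureGroup m → Vec m)
    (α : Label n → ℝ) : ℝ :=
  Omega W w + ∑ y ∈ Y, α y * P.violation W w y

theorem lagrangian_eq (W : Finset (FeatureGroup m)) (Y : Finset (Label n))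
    (w : FeatureGroup m → Vec m) (α : Label n → ℝ) :
    P.lagrangian W Y w α = Omega W w - ∑ d ∈ W, inner ℝ (w d) (∑ y ∈ Y, α y • P.a d y)
      + ∑ y ∈ Y, α y * P.b y := by
  simp only [lagrangian, violation, inner_sum, inner_smul_right, mul_sub, Finset.sum_sub_distrib,
    Finset.mul_sum]
  rw [Finset.sum_comm]
  ring

/-- The risk dominates every violation and is nonnegative, so weights of total mass at most `C`,
possibly less, collect at most `C` times it. -/
theorem lagrangian_le_JCut (W : Finset (FeatureGroup m)) {Y : Finset (Label n)}
    (w : FeatureGroup m → Vec m) {α : Label n → ℝ} (hα : α ∈ P.dualSet Y) :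
    P.lagrangian W Y w α ≤ P.JCut W Y w := by
  rw [lagrangian, JCut, cutRisk_eq]
  set r := Y.fold max 0 (P.violation W w) with hr
  obtain ⟨h0, hle⟩ := Finset.fold_max_le (c := r).1 hr.ge
  refine add_le_add_right ?_ _
  calc ∑ y ∈ Y, α y * P.violation W w y ≤ ∑ y ∈ Y, α y * r :=
        Finset.sum_le_sum fun y hy => mul_le_mul_of_nonneg_left (hle y hy) (hα.1 y)
    _ = (∑ y ∈ Y, α y) * r := (Finset.sum_mul ..).symm
    _ ≤ P.C * r := mul_le_mul_of_nonneg_right hα.2.2 h0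

/-- The Lagrangian is affine in `α`, so its maximum sits at a vertex of the dual set: `0` if the
risk is zero, otherwise mass `C` on a label attaining it. -/
theorem exists_JCut_le_lagrangian (hC : 0 < P.C) (W : Finset (FeatureGroup m))
    (Y : Finset (Label n)) (w : FeatureGroup m → Vec m) :
    ∃ α ∈ P.dualSet Y, P.JCut W Y w ≤ P.lagrangian W Y w α := by
  simp only [lagrangian, JCut, cutRisk_eq]
  rcases Finset.le_fold_max (Y.fold max 0 (P.violation W w)) |>.1 le_rfl with h | ⟨y, hy, h⟩
  · refine ⟨0, P.zero_mem_dualSet hC Y, ?_⟩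
    simpa using mul_nonpos_of_nonneg_of_nonpos hC.le h
  · refine ⟨Pi.single y P.C, ⟨fun y' => ?_, fun y' hy' => ?_, ?_⟩, ?_⟩
    · by_cases hyy : y' = y
      · subst hyy
        simpa using hC.le
      · simp [hyy]
    · exact Pi.single_eq_of_ne (by rintro rfl; exact hy' hy) _
    · simp [Finset.sum_pi_single', hy]
    · rw [Finset.sum_eq_single_of_mem y hy fun y' _ hyy => by simp [hyy]]
      simpa using mul_le_mul_of_nonneg_left h hC.le

/-- Weak duality. -/
theorem exists_theta_le_lagrangian {W : Finset (FeatureGroup m)} (hW : W.Nonempty)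
    (Y : Finset (Label n)) (w : FeatureGroup m → Vec m) (α : Label n → ℝ) :
    ∃ d ∈ W, P.Theta Y d α ≤ P.lagrangian W Y w α := by
  -- The linear part of `Theta` does not depend on the group, so the largest aggregate norm gives
  -- the smallest `Theta`.
  obtain ⟨d, hd, hmax⟩ := W.exists_max_image (fun d => ‖∑ y ∈ Y, α y • P.a d y‖) hW
  refine ⟨d, hd, ?_⟩
  rw [theta_eq, lagrangian_eq, Omega]
  have : ∑ d' ∈ W, inner ℝ (w d') (∑ y ∈ Y, α y • P.a d' y)
      ≤ (∑ d' ∈ W, ‖w d'‖) * ‖∑ y ∈ Y, α y • P.a d y‖ := by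
    rw [Finset.sum_mul]
    exact Finset.sum_le_sum fun d' hd' => (real_inner_le_norm _ _).trans
      (mul_le_mul_of_nonneg_left (hmax d' hd') (norm_nonneg _))
  -- With `s = ∑ ‖w d'‖` and `t` the largest aggregate norm, this is `s² / 2 - s t ≥ -t² / 2`.
  nlinarith [sq_nonneg (∑ d' ∈ W, ‖w d'‖ - ‖∑ y ∈ Y, α y • P.a d y‖)]

/-- The Lagrangian at a primal point supported on one group. -/
theorem lagrangian_single {W : Finset (FeatureGroup m)} (Y : Finset (Label n))
    {d : FeatureGroup m} (hd : d ∈ W) (α : Label n → ℝ) :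
    P.lagrangian W Y (Pi.single d (∑ y ∈ Y, α y • P.a d y)) α = P.Theta Y d α := by
  rw [theta_eq, lagrangian_eq, Omega,
    Finset.sum_eq_single_of_mem d hd fun d' _ h => by simp [h],
    Finset.sum_eq_single_of_mem d hd fun d' _ h => by simp [h]]
  simp only [Pi.single_eq_same, real_inner_self_eq_norm_sq]
  ring

theorem convexOn_lagrangian (W : Finset (FeatureGroup m)) (Y : Finset (Label n))
    (α : Label n → ℝ) (s : Set (FeatureGroup m → Vec m)) (hs : Convex ℝ s) :
    ConvexOn ℝ s fun w => P.lagrangian W Y w α := by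
  refine ⟨hs, fun u _ v _ s t hs ht hst => ?_⟩
  simp only [lagrangian_eq, Omega, Pi.add_apply, Pi.smul_apply, inner_add_left,
    real_inner_smul_left, Finset.sum_add_distrib, ← Finset.mul_sum, smul_eq_mul]
  have hnorm : ∑ d ∈ W, ‖s • u d + t • v d‖ ≤ s * ∑ d ∈ W, ‖u d‖ + t * ∑ d ∈ W, ‖v d‖ := by
    rw [Finset.mul_sum, Finset.mul_sum, ← Finset.sum_add_distrib]
    refine Finset.sum_le_sum fun d _ => (norm_add_le _ _).trans ?_
    rw [norm_smul_of_nonneg hs, norm_smul_of_nonneg ht]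
  have hsq := pow_le_pow_left₀ (Finset.sum_nonneg fun d _ => norm_nonneg _) hnorm 2
  obtain rfl : t = 1 - s := by linarith
  -- Convexity of the square: `s a² + t b² - (s a + t b)² = s t (a - b)²` when `s + t = 1`.
  nlinarith [mul_nonneg (mul_nonneg hs ht) (sq_nonneg (∑ d ∈ W, ‖u d‖ - ∑ d ∈ W, ‖v d‖))]

theorem concaveOn_lagrangian (W : Finset (FeatureGroup m)) (Y : Finset (Label n))
    (w : FeatureGroup m → Vec m) (s : Set (Label n → ℝ)) (hs : Convex ℝ s) :
    ConcaveOn ℝ s fun α => P.lagrangian W Y w α := by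
  refine ⟨hs, fun u _ v _ s t _ _ hst => le_of_eq ?_⟩
  simp only [lagrangian, Pi.add_apply, Pi.smul_apply, smul_eq_mul, add_mul, mul_assoc,
    Finset.sum_add_distrib, ← Finset.mul_sum]
  linear_combination Omega W w * hst

theorem continuous_lagrangian_left (W : Finset (FeatureGroup m)) (Y : Finset (Label n))
    (α : Label n → ℝ) : Continuous fun w => P.lagrangian W Y w α := by
  simp only [lagrangian, Omega, violation]
  fun_prop

theorem continuous_lagrangian_right (W : Finset (FeatureGroup m)) (Y : Finset (Label n))
    (w : FeatureGroup m → Vec m) : Continuous fun α => P.lagrangian W Y w α := by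
  simp only [lagrangian]
  fun_prop

/-- Strong duality, with attainment on both sides. -/
theorem exists_JCut_le_theta (hC : 0 < P.C) (W : Finset (FeatureGroup m)) (Y : Finset (Label n)) :
    ∃ w, ∃ α ∈ P.dualSet Y, ∀ d ∈ W, P.JCut W Y w ≤ P.Theta Y d α := by
  -- Sion's theorem is applied on a compact set of `w`. The radius `R` makes the ball contain the
  -- single-block points of `lagrangian_single` for every feasible `α`; these are the only
  -- competitors needed below.
  obtain ⟨R, hR⟩ := (P.isCompact_dualSet hC Y).exists_bound_of_continuousOn
    (f := fun α (d : FeatureGroup m) => ∑ y ∈ Y, α y • P.a d y) (by fun_prop)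
  have hR0 : 0 ≤ R := (norm_nonneg _).trans (hR 0 (P.zero_mem_dualSet hC Y))
  set X := Metric.closedBall (0 : FeatureGroup m → Vec m) R
  have hX : Convex ℝ X := convex_closedBall _ _
  have hA := P.convex_dualSet Y
  obtain ⟨w, -, α, hα, hsaddle⟩ := Sion.exists_isSaddlePointOn (X := X) (Y := P.dualSet Y)
    (f := fun w α => P.lagrangian W Y w α) ⟨0, by simpa [X] using hR0⟩ hX
    (isCompact_closedBall _ _)
    (fun α _ => (P.continuous_lagrangian_left W Y α).lowerSemicontinuous.lowerSemicontinuousOn _)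
    (fun α _ => (P.convexOn_lagrangian W Y α X hX).quasiconvexOn)
    hA ⟨0, P.zero_mem_dualSet hC Y⟩ (P.isCompact_dualSet hC Y)
    (fun w _ => (P.continuous_lagrangian_right W Y w).upperSemicontinuous.upperSemicontinuousOn _)
    (fun w _ => (P.concaveOn_lagrangian W Y w _ hA).quasiconcaveOn)
  refine ⟨w, α, hα, fun d hd => ?_⟩
  obtain ⟨β, hβ, hle⟩ := P.exists_JCut_le_lagrangian hC W Y w
  refine hle.trans ?_
  rw [← P.lagrangian_single Y hd α]
  -- The saddle inequality compares `(w, β)`, with `β` the best dual response to `w`, to the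
  -- single-block point paired with `α`.
  refine hsaddle _ ?_ β hβ
  rw [mem_closedBall_zero_iff, Pi.norm_single]
  exact (norm_le_pi_norm (fun d => ∑ y ∈ Y, α y • P.a d y) d).trans (hR α hα)

theorem exists_theta_le_JCut {W : Finset (FeatureGroup m)} (hW : W.Nonempty)
    {Y : Finset (Label n)} (w : FeatureGroup m → Vec m) {α : Label n → ℝ} (hα : α ∈ P.dualSet Y) :
    ∃ d ∈ W, P.Theta Y d α ≤ P.JCut W Y w :=
  let ⟨d, hd, h⟩ := P.exists_theta_le_lagrangian hW Y w α
  ⟨d, hd, h.trans (P.lagrangian_le_JCut W w hα)⟩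

/-- No coercivity argument is needed: the dual part of the saddle point certifies that its primal
part is a global minimizer. -/
theorem exists_isReducedPrimalSolution (hC : 0 < P.C) {W : Finset (FeatureGroup m)}
    (hW : W.Nonempty) (Y : Finset (Label n)) : ∃ w, P.IsReducedPrimalSolution W Y w := by
  obtain ⟨w, α, hα, h⟩ := P.exists_JCut_le_theta hC W Y
  refine ⟨w, fun w' => ?_⟩
  obtain ⟨d, hd, hle⟩ := P.exists_theta_le_JCut hW w' hα
  exact (h d hd).trans hle

/-- This and `qcqpFeasible_of_le_theta` eliminate `θ`: the QCQP maximizes `min_{d ∈ W} Theta Y d α`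
over `α`. -/
theorem QCQPFeasible.le_theta {P : Problem n m} {W : Finset (FeatureGroup m)}
    {Y : Finset (Label n)} {α : Label n → ℝ} {θ : ℝ} (h : P.QCQPFeasible W Y α θ)
    {d : FeatureGroup m} (hd : d ∈ W) : -θ + ∑ y ∈ Y, α y * P.q y ≤ P.Theta Y d α := by
  rw [Theta, reducedG]
  linarith [h.2 d hd]

theorem qcqpFeasible_of_le_theta {W : Finset (FeatureGroup m)} {Y : Finset (Label n)}
    {α : Label n → ℝ} (hα : α ∈ P.dualSet Y) {v : ℝ} (h : ∀ d ∈ W, v ≤ P.Theta Y d α) :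
    P.QCQPFeasible W Y α (∑ y ∈ Y, α y * P.q y - v) := by
  refine ⟨hα, fun d hd => ?_⟩
  have := h d hd
  rw [Theta, reducedG] at this
  linarith

theorem exists_isQCQPSolution (hC : 0 < P.C) {W : Finset (FeatureGroup m)}
    (hW : W.Nonempty) (Y : Finset (Label n)) : ∃ α, P.IsQCQPSolution W Y α := by
  obtain ⟨w, α, hα, h⟩ := P.exists_JCut_le_theta hC W Y
  refine ⟨α, _, P.qcqpFeasible_of_le_theta hα h, fun α' θ' h' => ?_⟩
  obtain ⟨d, hd, hle⟩ := P.exists_theta_le_JCut hW w h'.1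
  linarith [h'.le_theta hd]

theorem IsQCQPSolution.mem_dualSet {P : Problem n m} {W : Finset (FeatureGroup m)}
    {Y : Finset (Label n)} {α : Label n → ℝ} (h : P.IsQCQPSolution W Y α) : α ∈ P.dualSet Y :=
  let ⟨_, hf, _⟩ := h
  hf.1

/-- The primal and dual solutions are chosen independently. Each is at least as good as its half of
the saddle point, so the inequality transfers. -/
theorem JCut_le_theta_of_isQCQPSolution (hC : 0 < P.C) {W : Finset (FeatureGroup m)}
    {Y : Finset (Label n)} {w : FeatureGroup m → Vec m} {α : Label n → ℝ}
    (hw : P.IsReducedPrimalSolution W Y w) (hα : P.IsQCQPSolution W Y α) {d : FeatureGroup m}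
    (hd : d ∈ W) : P.JCut W Y w ≤ P.Theta Y d α := by
  obtain ⟨w', α', hα', h⟩ := P.exists_JCut_le_theta hC W Y
  obtain ⟨θ, hf, hmax⟩ := hα
  have := hmax α' _ (P.qcqpFeasible_of_le_theta hα' h)
  linarith [hf.le_theta hd, hw w']

/-! ### The relaxed problem -/

theorem single_mem_weightSet {G : Finset (FeatureGroup m)} {d : FeatureGroup m} (hd : d ∈ G) :
    Pi.single d (1 : ℝ) ∈ weightSet G := by
  refine ⟨fun d' => ?_, fun d' hd' => Pi.single_eq_of_ne (by rintro rfl; exact hd' hd) _, ?_⟩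
  · by_cases h : d' = d
    · subst h
      simp
    · simp [h]
  · simp [Finset.sum_pi_single', hd]

theorem mklObjective_eq_sum {G : Finset (FeatureGroup m)} {μ : FeatureGroup m → ℝ}
    (hμ : μ ∈ weightSet G) (α : Label n → ℝ) :
    P.mklObjective G α μ = ∑ d ∈ G, μ d * P.S α d := by
  simp only [mklObjective, S, mul_add, Finset.sum_add_distrib, ← Finset.sum_mul, hμ.2.2, one_mul]
  congr 1
  simp only [Finset.mul_sum]
  rw [Finset.sum_comm' (t' := P.alternatives) (s' := fun _ => G) (by simp)]
  refine Finset.sum_congr rfl fun y _ => ?_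
  rw [Finset.sum_comm]
  exact Finset.sum_congr rfl fun d _ => Finset.sum_congr rfl fun y' _ => by ring

theorem mklObjective_single {G : Finset (FeatureGroup m)} {d : FeatureGroup m} (hd : d ∈ G)
    (α : Label n → ℝ) : P.mklObjective G α (Pi.single d 1) = P.S α d := by
  rw [P.mklObjective_eq_sum (single_mem_weightSet hd),
    Finset.sum_eq_single_of_mem d hd fun d' _ h => by simp [h]]
  simp

/-- A weighted average cannot lie strictly below all its terms: equality of the sums would force
every weight to vanish, against total mass `1`. -/
theorem exists_S_le_mklObjective {G : Finset (FeatureGroup m)} {μ : FeatureGroup m → ℝ}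
    (hμ : μ ∈ weightSet G) (α : Label n → ℝ) : ∃ d ∈ G, P.S α d ≤ P.mklObjective G α μ := by
  by_contra! h
  rw [P.mklObjective_eq_sum hμ] at h
  set v := ∑ d ∈ G, μ d * P.S α d with hv
  have hle : ∀ d ∈ G, μ d * v ≤ μ d * P.S α d := fun d hd =>
    mul_le_mul_of_nonneg_left (h d hd).le (hμ.1 d)
  have hsum : ∑ d ∈ G, μ d * v = ∑ d ∈ G, μ d * P.S α d := by
    rw [← Finset.sum_mul, hμ.2.2, one_mul]
  have heq := (Finset.sum_eq_sum_iff_of_le hle).1 hsum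
  have hzero : ∑ d ∈ G, μ d = 0 := Finset.sum_eq_zero fun d hd => by
    by_contra hne
    exact (h d hd).ne (mul_left_cancel₀ hne (heq d hd))
  linarith [hμ.2.2]

/-- An optimal pair solves `max_α min_d S(α, d)`. -/
theorem isOptimalPair_spec {G : Finset (FeatureGroup m)} {d : FeatureGroup m} {α : Label n → ℝ}
    (h : P.IsOptimalPair G d α) :
    α ∈ P.dualSet P.alternatives ∧ (∀ d' ∈ G, P.S α d ≤ P.S α d') ∧
      ∀ α' ∈ P.dualSet P.alternatives, ∃ d' ∈ G, P.S α' d' ≤ P.S α d := by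
  obtain ⟨μ, hμ, hd⟩ := h
  have hmin : ∀ d' ∈ G, P.mklObjective G α μ ≤ P.S α d' := fun d' hd' =>
    P.mklObjective_single hd' α ▸ hμ.inner_min _ (single_mem_weightSet hd')
  have hdG : d ∈ G := by
    by_contra hne
    exact hd.ne' (hμ.weight_mem.2.1 d hne)
  -- Complementary slackness: an average equal to a lower bound of its terms forces every term of
  -- positive weight to attain that bound.
  have hval : P.mklObjective G α μ = P.S α d := by
    have hle : ∀ d' ∈ G, μ d' * P.mklObjective G α μ ≤ μ d' * P.S α d' := fun d' hd' =>
      mul_le_mul_of_nonneg_left (hmin d' hd') (hμ.weight_mem.1 d')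
    have hsum : ∑ d' ∈ G, μ d' * P.mklObjective G α μ = ∑ d' ∈ G, μ d' * P.S α d' := by
      rw [← Finset.sum_mul, hμ.weight_mem.2.2, one_mul, P.mklObjective_eq_sum hμ.weight_mem]
    exact mul_left_cancel₀ hd.ne' ((Finset.sum_eq_sum_iff_of_le hle).1 hsum d hdG)
  refine ⟨hμ.dual_mem, fun d' hd' => hval ▸ hmin d' hd', fun α' hα' => ?_⟩
  obtain ⟨μ', hμ', hle⟩ := hμ.outer_max α' hα'
  obtain ⟨d', hd', hle'⟩ := P.exists_S_le_mklObjective hμ' α'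
  exact ⟨d', hd', hval ▸ hle'.trans hle⟩

/-- The inner minimum is attained at a vertex of the weight simplex, so it remains to maximize a
minimum of finitely many continuous functions over a compact set. -/
theorem exists_isOptimalPair (hC : 0 < P.C) {G : Finset (FeatureGroup m)} (hG : G.Nonempty) :
    ∃ d α, P.IsOptimalPair G d α := by
  obtain ⟨α, hα, hmax⟩ := (P.isCompact_dualSet hC P.alternatives).exists_isMaxOn
    ⟨0, P.zero_mem_dualSet hC _⟩
    (f := fun α => G.inf' hG fun d => P.Theta P.alternatives d α)
    (Continuous.finset_inf'_apply hG fun d _ => P.continuous_theta _ d).continuousOn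
  obtain ⟨d, hd, hmin⟩ := G.exists_min_image (P.S α) hG
  refine ⟨d, α, Pi.single d 1, ⟨hα, single_mem_weightSet hd, fun μ' hμ' => ?_, fun α' hα' => ?_⟩,
    by simp⟩
  · obtain ⟨d', hd', hle⟩ := P.exists_S_le_mklObjective hμ' α
    rw [P.mklObjective_single hd]
    exact (hmin d' hd').trans hle
  · obtain ⟨d', hd', hd'eq⟩ := G.exists_mem_eq_inf' hG fun d => P.Theta P.alternatives d α'
    refine ⟨Pi.single d' 1, single_mem_weightSet hd', ?_⟩
    rw [P.mklObjective_single hd, P.mklObjective_single hd', S_eq_theta, S_eq_theta, ← hd'eq]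
    exact (hmax hα').trans (Finset.inf'_le _ hd)

/-! ### Most violated groups and labels -/

theorem exists_isMostViolatedGroup (Y : Finset (Label n)) (α : Label n → ℝ) :
    ∃ d, P.IsMostViolatedGroup Y α d :=
  let ⟨d, hd, h⟩ := P.groups.exists_max_image (fun d => P.reducedG Y d α)
    ⟨∅, by simp [groups]⟩
  ⟨d, hd, h⟩

theorem exists_isMostViolatedLabel (hY : P.alternatives.Nonempty) (W : Finset (FeatureGroup m))
    (w : FeatureGroup m → Vec m) : ∃ y', P.IsMostViolatedLabel W w y' :=
  let ⟨y', hy', h⟩ := P.alternatives.exists_max_image (fun y' => P.loss P.y y' -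
    ∑ i, (((P.y i : ℤ) : ℝ) - ((y' i : ℤ) : ℝ)) * ∑ d ∈ W, inner ℝ (w d) (mask (P.x i) d)) hY
  ⟨y', hy', h⟩

/-- If a most violated label vector is in the working set, the cutting plane model is exact. -/
theorem J_le_JCut_of_mem (hC : 0 < P.C) {W : Finset (FeatureGroup m)} {Y : Finset (Label n)}
    {w : FeatureGroup m → Vec m} {y' : Label n} (h : P.IsMostViolatedLabel W w y') (hy : y' ∈ Y) :
    P.J W w ≤ P.JCut W Y w := by
  rw [J, JCut, cutRisk_eq]
  refine add_le_add_right (mul_le_mul_of_nonneg_left ?_ hC.le) _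
  obtain ⟨h0, hle⟩ := Finset.fold_max_le (c := Y.fold max 0 (P.violation W w)) |>.1 le_rfl
  exact (Finset.fold_max_le _).2 ⟨h0, fun y'' hy'' =>
    (P.violation_le_of_isMostViolatedLabel h hy'').trans (hle y' hy)⟩

end Problem

/-! ### Reachable states -/

variable {n m : ℕ} {P : Problem n m} {ε : ℝ}

/-- A property of all states that a run of the algorithm can reach. -/
def Invariant (P : Problem n m) (ε : ℝ) : State n m → Prop
  | .generate W Y α => W ⊆ P.groups ∧ ∀ d ∈ W, ¬ P.IsMostViolatedGroup Y α d
  | .select W Y w best => W.Nonempty ∧ W ⊆ P.groups ∧ Y ⊆ P.alternatives ∧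
      (Y = ∅ ∨ (best ≤ P.J W w ∧ ε < best - P.JCut W Y w)) ∧ ∃ w', best = P.J W w'
  | .finished W Y d α => W ⊆ P.groups ∧ Y ⊆ P.alternatives ∧ d ∈ W ∧
      P.IsMostViolatedGroup Y α d ∧ P.IsQCQPSolution W Y α ∧
      ∃ w w', P.IsReducedPrimalSolution W Y w ∧ P.J W w' - P.JCut W Y w ≤ ε

/-- An upper bound for the number of steps that are left. -/
def potential : State n m → ℕ
  | .generate W _ _ => (Fintype.card (FeatureGroup m) - W.card) * (Fintype.card (Label n) + 2)
  | .select W Y _ _ => (Fintype.card (FeatureGroup m) - W.card) * (Fintype.card (Label n) + 2)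
      + (Fintype.card (Label n) - Y.card) + 1
  | .finished _ _ _ _ => 0

theorem InnerIteration.subset {W : Finset (FeatureGroup m)} {Y Y' : Finset (Label n)}
    {w w' : FeatureGroup m → Vec m} {α' : Label n → ℝ} (h : InnerIteration P W Y w Y' w' α')
    (hY : Y ⊆ P.alternatives) : Y' ⊆ P.alternatives := by
  obtain ⟨⟨y', hy', rfl⟩, -⟩ := h
  exact Finset.insert_subset hy'.1 hY

theorem exists_min_eq_J (W : Finset (FeatureGroup m)) {best : ℝ}
    (hbest : ∃ w, best = P.J W w) (w' : FeatureGroup m → Vec m) :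
    ∃ w, min best (P.J W w') = P.J W w := by
  rcases min_choice best (P.J W w') with h | h
  · rwa [h]
  · exact ⟨w', h⟩

theorem Invariant.of_isInitial {s : State n m} (h : IsInitial P s) : Invariant P ε s := by
  obtain ⟨α, -, rfl⟩ := h
  simp [Invariant]

theorem Invariant.step {s t : State n m} (hs : Invariant P ε s) (h : Step P ε s t) :
    Invariant P ε t := by
  cases h with
  | generate w₀ hd =>
    exact ⟨Finset.insert_nonempty _ _, Finset.insert_subset hd.1 hs.1, Finset.empty_subset _,
      Or.inl rfl, w₀, rfl⟩
  | again hi hε =>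
    obtain ⟨hW, hWG, hYA, -, hbest⟩ := hs
    exact ⟨hW, hWG, hi.subset hYA, Or.inr ⟨min_le_right _ _, not_le.1 hε⟩,
      exists_min_eq_J _ hbest _⟩
  | back hi hε hc =>
    exact ⟨hs.2.1, fun d hd hd' => hc ⟨d, hd, hd'⟩⟩
  | halt hi hε hd hc =>
    obtain ⟨hW, hWG, hYA, -, hbest⟩ := hs
    obtain ⟨w, hw⟩ := exists_min_eq_J _ hbest _
    exact ⟨hWG, hi.subset hYA, hd, hc, hi.2.2, _, w, hi.2.1, hw ▸ hε⟩

theorem Invariant.of_reflTransGen {s t : State n m} (hs : Invariant P ε s)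
    (h : Relation.ReflTransGen (Step P ε) s t) : Invariant P ε t := by
  induction h with
  | refl => exact hs
  | tail _ h ih => exact ih.step h

theorem potential_lt_of_step (hC : 0 < P.C) (hε : 0 ≤ ε) {s t : State n m}
    (hs : Invariant P ε s) (h : Step P ε s t) : potential t < potential s := by
  cases h with
  | @generate W Y α d w₀ hd =>
    have hdW : d ∉ W := fun hdW => hs.2 d hdW hd
    have hlt := Finset.card_le_univ (insert d W)
    rw [Finset.card_insert_of_notMem hdW] at hlt
    -- One block of `card (Label n) + 2` pays for an outer iteration: this step, at most `card
    -- (Label n)` repeated inner iterations, and the step leaving the inner layer.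
    simp only [potential, Finset.card_insert_of_notMem hdW, Finset.card_empty]
    obtain ⟨k, hk⟩ := Nat.exists_eq_add_of_le hlt
    rw [hk, Nat.add_sub_cancel_left, show W.card + 1 + k - W.card = k + 1 by omega, add_mul]
    omega
  | @again W Y w best Y' w' α' hi hε' =>
    obtain ⟨⟨y', hy', rfl⟩, -⟩ := hi
    -- A repeated label would give `best ≤ J W w ≤ JCut W Y w`, contradicting the gap above `ε ≥ 0`
    -- recorded when the previous inner iteration did not exit.
    have hyY : y' ∉ Y := by
      intro hmem
      rcases hs.2.2.2.1 with rfl | ⟨h1, h2⟩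
      · exact absurd hmem (Finset.notMem_empty _)
      · linarith [P.J_le_JCut_of_mem hC hy' hmem]
    have hlt := Finset.card_le_univ (insert y' Y)
    rw [Finset.card_insert_of_notMem hyY] at hlt
    simp only [potential, Finset.card_insert_of_notMem hyY]
    omega
  | back => simp only [potential]; omega
  | halt => simp only [potential]; omega

theorem exists_step (hC : 0 < P.C) (hY : P.alternatives.Nonempty) {s : State n m}
    (hs : Invariant P ε s) : IsFinished s ∨ ∃ t, Step P ε s t := by
  cases s with
  | generate W Y α =>
    obtain ⟨d, hd⟩ := P.exists_isMostViolatedGroup Y α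
    exact Or.inr ⟨_, .generate 0 hd⟩
  | select W Y w best =>
    obtain ⟨y', hy'⟩ := P.exists_isMostViolatedLabel hY W w
    obtain ⟨w', hw'⟩ := P.exists_isReducedPrimalSolution hC hs.1 (insert y' Y)
    obtain ⟨α', hα'⟩ := P.exists_isQCQPSolution hC hs.1 (insert y' Y)
    have hi : InnerIteration P W Y w (insert y' Y) w' α' := ⟨⟨y', hy', rfl⟩, hw', hα'⟩
    refine Or.inr ?_
    by_cases hε : min best (P.J W w') - P.JCut W (insert y' Y) w' ≤ ε
    · by_cases hc : ∃ d ∈ W, P.IsMostViolatedGroup (insert y' Y) α' d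
      · obtain ⟨d, hd, hc⟩ := hc
        exact ⟨_, .halt hi hε hd hc⟩
      · exact ⟨_, .back hi hε hc⟩
    · exact ⟨_, .again hi hε⟩
  | finished W Y d α => exact Or.inl ⟨W, Y, d, α, rfl⟩

/-- The lower bound needs `G` inside the groups over which `d` is optimal; the upper bound needs `G`
to contain the pool on which duality was solved. This covers both choices of `G` at once. -/
theorem Invariant.gap_bounds (hC : 0 < P.C) {W : Finset (FeatureGroup m)} {Y : Finset (Label n)}
    {d : FeatureGroup m} {α : Label n → ℝ} (hs : Invariant P ε (.finished W Y d α))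
    {G : Finset (FeatureGroup m)} (hWG : W ⊆ G) (hG : G ⊆ P.groups) {dstar : FeatureGroup m}
    {αstar : Label n → ℝ} (h : P.IsOptimalPair G dstar αstar) :
    0 ≤ P.S αstar dstar - P.Theta Y d α ∧ P.S αstar dstar - P.Theta Y d α ≤ ε := by
  obtain ⟨-, hYA, hd, hmv, hsol, w, w', hw, hgap⟩ := hs
  obtain ⟨hαstar, hmin, hmax⟩ := P.isOptimalPair_spec h
  constructor
  · obtain ⟨d', hd', hle⟩ := hmax α (P.dualSet_mono hYA hsol.mem_dualSet)
    rw [P.S_eq_theta α, P.theta_mono hYA _ hsol.mem_dualSet] at hle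
    have : P.Theta Y d α ≤ P.Theta Y d' α := neg_le_neg (hmv.2 d' (hG hd'))
    linarith
  -- Here `w'` is the point realizing the best value of `J`, and weak duality is taken with all
  -- alternatives, where `JCut` is `J`.
  · obtain ⟨d', hd', hle⟩ := P.exists_theta_le_JCut ⟨d, hd⟩ w' hαstar
    rw [← P.S_eq_theta, ← P.J_eq_JCut] at hle
    linarith [hmin d' (hWG hd'), P.JCut_le_theta_of_isQCQPSolution hC hw hsol hd]

end TwoLayer

end

theorem mainTheorem1 {n m : ℕ} (P : TwoLayer.Problem n m) (hC : 0 < P.C)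
    (hY : P.alternatives.Nonempty) (ε : ℝ) (hε : 0 ≤ ε) :
    -- the number of steps of all runs is bounded
    (∃ N : ℕ, ∀ (l : ℕ) (s : ℕ → TwoLayer.State n m), TwoLayer.IsInitial P (s 0) →
      (∀ i < l, TwoLayer.Step P ε (s i) (s (i + 1))) → l ≤ N) ∧
    -- a run never gets stuck before it stops
    (∀ s₀ s : TwoLayer.State n m, TwoLayer.IsInitial P s₀ →
      Relation.ReflTransGen (TwoLayer.Step P ε) s₀ s →
      TwoLayer.IsFinished s ∨ ∃ s', TwoLayer.Step P ε s s') ∧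
    -- the output is within `ε` of the optimum, both over the final pool and over all groups
    (∀ (s₀ : TwoLayer.State n m) (W : Finset (TwoLayer.FeatureGroup m))
      (Y : Finset (TwoLayer.Label n)) (d : TwoLayer.FeatureGroup m) (α : TwoLayer.Label n → ℝ),
      TwoLayer.IsInitial P s₀ →
      Relation.ReflTransGen (TwoLayer.Step P ε) s₀ (.finished W Y d α) →
      d ∈ P.groups ∧ α ∈ P.dualSet P.alternatives ∧
      ∀ G : Finset (TwoLayer.FeatureGroup m), (G = W ∨ G = P.groups) →
        (∃ dstar αstar, P.IsOptimalPair G dstar αstar) ∧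
        ∀ dstar αstar, P.IsOptimalPair G dstar αstar →
          0 ≤ P.S αstar dstar - P.Theta Y d α ∧ P.S αstar dstar - P.Theta Y d α ≤ ε) := by
  refine ⟨⟨Fintype.card (TwoLayer.FeatureGroup m) * (Fintype.card (TwoLayer.Label n) + 2),
    fun l s h0 hstep => ?_⟩, fun s₀ s h0 hrun => ?_, fun s₀ W Y d α h0 hrun => ?_⟩
  · have key : ∀ i ≤ l, TwoLayer.Invariant P ε (s i) ∧
        i + TwoLayer.potential (s i) ≤ TwoLayer.potential (s 0) := by
      intro i
      induction i with
      | zero => exact fun _ => ⟨.of_isInitial h0, by simp⟩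
      | succ i ih =>
        intro hi
        obtain ⟨hinv, hle⟩ := ih (by omega)
        have hst := hstep i (by omega)
        have := TwoLayer.potential_lt_of_step hC hε hinv hst
        exact ⟨hinv.step hst, by omega⟩
    have hle := (key l le_rfl).2
    -- The initial pool is empty, so the initial potential is the claimed constant, whatever the
    -- starting `α`.
    obtain ⟨α, -, hs0⟩ := h0
    simp only [hs0, TwoLayer.potential, Finset.card_empty, Nat.sub_zero] at hle
    omega
  · exact TwoLayer.exists_step hC hY ((TwoLayer.Invariant.of_isInitial h0).of_reflTransGen hrun)
  · have hinv : TwoLayer.Invariant P ε (.finished W Y d α) :=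
      (TwoLayer.Invariant.of_isInitial h0).of_reflTransGen hrun
    have hWG := hinv.1
    have hdW := hinv.2.2.1
    refine ⟨hWG hdW, P.dualSet_mono hinv.2.1 hinv.2.2.2.2.1.mem_dualSet, fun G hG => ?_⟩
    have hsub : W ⊆ G ∧ G ⊆ P.groups := by
      rcases hG with rfl | rfl
      · exact ⟨subset_rfl, hWG⟩
      · exact ⟨hWG, subset_rfl⟩
    exact ⟨P.exists_isOptimalPair hC ⟨d, hsub.1 hdW⟩,
      fun _ _ h => hinv.gap_bounds hC hsub.1 hsub.2 h⟩
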